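/- Let $\mathbb{H}$ be the division ring of quaternions. A right quaternionic Hilbert space is a right $\mathbb{H}$-vector space with a map $\langle\cdot\mid\cdot\rangle$ into $\mathbb{H}$ that is additive in the second variable and satisfies $\overline{\langle\phi\mid\psi\rangle}=\langle\psi\mid\phi\rangle$, $\langle\phi\mid\psi q\rangle=\langle\phi\mid\psi\rangle q$ for all $q\in\mathbb{H}$, and $\langle\phi\mid\phi\rangle>0$ for $\phi\neq 0$, and which is complete and separable in the norm $\|\phi\|=\langle\phi\mid\phi\rangle^{1/2}$. Let $V$ and $U$ be right quaternionic Hilbert spaces and let $B(V,U)$ be the set of bounded right $\mathbb{H}$-linear operators $V\to U$. An operator $A\in B(V,U)$ is called Fredholm if $\ker A$ and $\operatorname{coker}A=U/\operatorname{ran}A$ are finite dimensional over $\mathbb{H}$, and its index is then $$\operatorname{ind}(A)=\dim_{\mathbb{H}}\ker A-\dim_{\mathbb{H}}\operatorname{coker}A .$$ An operator $K\in B(V,U)$ is called compact if the image under $K$ of the closed unit ball of $V$ has compact closure in $U$. Theorem. If $A\in B(V,U)$ is Fredholm, then for every compact operator $K\in B(V,U)$ the operator $A+K$ is Fredholm and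 $\operatorname{ind}(A+K)=\operatorname{ind}(A)$. -/

import Mathlib

open scoped Quaternion

/-- A right quaternionic Hilbert space: a right vector space `V` over the quaternions `ℍ`
(that is, a module over `ℍᵐᵒᵖ`, the right multiple `φ q` being `MulOpposite.op q • φ`)
with an `ℍ`-valued inner product `⟨φ ∣ ψ⟩ = inner ℍ φ ψ`, right linear in the second variable and
Hermitian, whose norm `‖φ‖ = ⟨φ ∣ φ⟩ ^ (1/2)` is complete and separable.
Positive definiteness is part of `inner_self_eq`, since `‖φ‖` is a norm. -/
class RightQuaternionicHilbertSpace (V : Type*) [NormedAddCommGroup V] [Module ℍᵐᵒᵖ V]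
    extends Inner ℍ V, CompleteSpace V, TopologicalSpace.SeparableSpace V where
  /-- `⟨φ ∣ ψ⟩` and `⟨ψ ∣ φ⟩` are conjugate quaternions. -/
  star_inner : ∀ φ ψ : V, star (inner φ ψ) = inner ψ φ
  /-- `⟨φ ∣ φ⟩ = ‖φ‖ ^ 2`, a real quaternion. -/
  inner_self_eq : ∀ φ : V, inner φ φ = ((‖φ‖ ^ 2 : ℝ) : ℍ)
  /-- `⟨φ ∣ ψ + ω⟩ = ⟨φ ∣ ψ⟩ + ⟨φ ∣ ω⟩`. -/
  inner_add_right : ∀ φ ψ ω : V, inner φ (ψ + ω) = inner φ ψ + inner φ ω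
  /-- `⟨φ ∣ ψ q⟩ = ⟨φ ∣ ψ⟩ q`. -/
  inner_op_smul_right : ∀ (φ ψ : V) (q : ℍ), inner φ (MulOpposite.op q • ψ) = inner φ ψ * q

namespace RightQuaternionic

variable {V U : Type*} [NormedAddCommGroup V] [Module ℍᵐᵒᵖ V] [RightQuaternionicHilbertSpace V]
  [NormedAddCommGroup U] [Module ℍᵐᵒᵖ U] [RightQuaternionicHilbertSpace U]

/-- A bounded right linear operator `A` is Fredholm if its kernel and its cokernel `U / ran A`
are finite dimensional right quaternionic vector spaces. The range is not assumed closed. -/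
def IsFredholm (A : V →L[ℍᵐᵒᵖ] U) : Prop :=
  FiniteDimensional ℍᵐᵒᵖ (LinearMap.ker (A : V →ₗ[ℍᵐᵒᵖ] U)) ∧
    FiniteDimensional ℍᵐᵒᵖ (U ⧸ LinearMap.range (A : V →ₗ[ℍᵐᵒᵖ] U))

/-- The index `dim ker A - dim coker A`, with quaternionic dimensions (meaningful when `A` is
Fredholm). -/
noncomputable def index (A : V →L[ℍᵐᵒᵖ] U) : ℤ :=
  (Module.finrank ℍᵐᵒᵖ (LinearMap.ker (A : V →ₗ[ℍᵐᵒᵖ] U)) : ℤ) -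
    (Module.finrank ℍᵐᵒᵖ (U ⧸ LinearMap.range (A : V →ₗ[ℍᵐᵒᵖ] U)) : ℤ)

end RightQuaternionic

/-! Restricting scalars to `ℝ` makes `V` and `U` real Banach spaces and multiplies all dimensions,
hence the index, by 4, so the statement for Banach spaces suffices. There, let `C` be a complement
of `ran A`. Then `A = g ∘ i` with `i : E → E × C` the inclusion and `g (x, c) = A x + c` surjective
with a bounded right inverse `R`. Now `A + K = g ∘ (1 + L) ∘ i` with `L (x, c) = R (K x)` compact.
Since the index is additive under composition, only `ind (1 + L) = 0` is needed, which is
`nonempty_ker_equiv_coker_id_add`. -/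

section CompactPerturbation

variable {𝕜 E F : Type*} [RCLike 𝕜] [NormedAddCommGroup E] [NormedSpace 𝕜 E] [CompleteSpace E]
  [NormedAddCommGroup F] [NormedSpace 𝕜 F] [CompleteSpace F]

/-- A surjective bounded operator between Banach spaces with finite dimensional kernel has a
bounded right inverse. -/
theorem ContinuousLinearMap.exists_rightInverse_of_finiteDimensional_ker (f : E →L[𝕜] F)
    (hf : Function.Surjective f) [FiniteDimensional 𝕜 f.ker] :
    ∃ g : F →L[𝕜] E, ∀ y, f (g y) = y := by
  obtain ⟨p, hp⟩ := Submodule.ClosedComplemented.of_finiteDimensional f.ker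
  have hpr : p.range = ⊤ := LinearMap.range_eq_top.2 fun x ↦ ⟨x, hp x⟩
  let e := ContinuousLinearMap.equivProdOfSurjectiveOfIsCompl f p (LinearMap.range_eq_top.2 hf) hpr
    (LinearMap.isCompl_of_proj hp)
  refine ⟨e.symm.toContinuousLinearMap ∘L ContinuousLinearMap.inl 𝕜 F f.ker, fun y ↦ ?_⟩
  have : e (e.symm (y, 0)) = (y, 0) := e.apply_symm_apply _
  exact congrArg Prod.fst this

/-! ### Riesz theory of `1 + K` for compact `K` -/

namespace IsCompactOperator

variable {K : E →L[𝕜] E}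

-- On the closed subspace `ker (1 + K)` the identity equals `-K`, hence is compact.
omit [CompleteSpace E] in
theorem finiteDimensional_ker_id_add (hK : IsCompactOperator K) :
    FiniteDimensional 𝕜 (ContinuousLinearMap.id 𝕜 E + K).ker := by
  set N := (ContinuousLinearMap.id 𝕜 E + K).ker with hN
  have hcl : IsClosed (N : Set E) := (ContinuousLinearMap.id 𝕜 E + K).isClosed_ker
  have hmem : ∀ x : N, -K x = x := fun x ↦ by
    have h : (x : E) + K x = 0 := x.2
    exact (eq_neg_of_add_eq_zero_left h).symm
  have h1 : IsCompactOperator (fun x : N ↦ -K x) := (hK.comp_clm N.subtypeL).neg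
  have h2 := IsCompactOperator.codRestrict h1 (V := N) (fun x ↦ by rw [hmem]; exact x.2) hcl
  refine FiniteDimensional.of_isCompactOperator_id (𝕜 := 𝕜) (E := N) ?_
  have hid : (id : N → N) = Set.codRestrict (fun x : N ↦ -K x) N
      (fun x ↦ by rw [hmem]; exact x.2) :=
    funext fun x ↦ Subtype.ext (hmem x).symm
  rw [hid]
  exact h2

theorem surjective_id_add_of_injective (hK : IsCompactOperator K)
    (h : Function.Injective (ContinuousLinearMap.id 𝕜 E + K)) :
    Function.Surjective (ContinuousLinearMap.id 𝕜 E + K) := by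
  rcases hK.hasEigenvalue_or_mem_resolventSet (μ := -1) (by simp) with h1 | h1
  · obtain ⟨x, hx, hx0⟩ := h1.exists_hasEigenvector
    refine absurd (h (a₁ := x) (a₂ := 0) ?_) hx0
    have : K x = -1 • x := by simpa using hx
    simp [this]
  -- Being in the resolvent set means that `-1 - K` is a unit; its negative is `1 + K`.
  · rw [spectrum.mem_resolventSet_iff, ← IsUnit.neg_iff,
      ContinuousLinearMap.isUnit_iff_bijective] at h1
    convert h1.2 using 2
    ext x
    simp [add_comm]

/-- A right inverse `R` satisfies `R = 1 - K R`, so it is an injective compact perturbation of the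
identity, hence bijective; `1 + K` is then its inverse. -/
theorem injective_id_add_of_surjective (hK : IsCompactOperator K)
    (h : Function.Surjective (ContinuousLinearMap.id 𝕜 E + K)) :
    Function.Injective (ContinuousLinearMap.id 𝕜 E + K) := by
  have := hK.finiteDimensional_ker_id_add
  obtain ⟨R, hR⟩ := (ContinuousLinearMap.id 𝕜 E + K).exists_rightInverse_of_finiteDimensional_ker h
  have hRK : R = ContinuousLinearMap.id 𝕜 E + -(K ∘L R) := by
    ext x
    have : R x + K (R x) = x := hR x
    simpa [sub_eq_add_neg] using eq_sub_of_add_eq this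
  have hcomp : IsCompactOperator (-(K ∘L R)) := (hK.comp_clm R).neg
  have hinj : Function.Injective R := Function.LeftInverse.injective hR
  rw [hRK] at hinj
  have hsurj := hcomp.surjective_id_add_of_injective hinj
  rw [← hRK] at hsurj
  intro x y hxy
  obtain ⟨x, rfl⟩ := hsurj x
  obtain ⟨y, rfl⟩ := hsurj y
  rw [hR, hR] at hxy
  rw [hxy]

/-- Riesz: a compact perturbation of the identity has cokernel linearly equivalent to its kernel. -/
theorem nonempty_ker_equiv_coker_id_add (hK : IsCompactOperator K) :
    Nonempty ((ContinuousLinearMap.id 𝕜 E + K).ker ≃ₗ[𝕜]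
      E ⧸ (ContinuousLinearMap.id 𝕜 E + K).range) := by
  have hfin := hK.finiteDimensional_ker_id_add
  set S := ContinuousLinearMap.id 𝕜 E + K with hS
  obtain ⟨C, hC⟩ := S.range.exists_isCompl
  obtain ⟨p, hp⟩ := Submodule.ClosedComplemented.of_finiteDimensional S.ker
  -- The finite rank correction `g ∘ p` keeps `S` of the form identity plus compact, and `S + g ∘ p`
  -- is injective or surjective as soon as `g` is.
  let G (g : S.ker →ₗ[𝕜] C) : S.ker →L[𝕜] E :=
    ⟨C.subtype ∘ₗ g, LinearMap.continuous_of_finiteDimensional _⟩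
  have hG (g : S.ker →ₗ[𝕜] C) : IsCompactOperator (K + G g ∘L p) := by
    have := FiniteDimensional.proper 𝕜 S.ker
    have h : IsCompactOperator (G g) := isCompactOperator_of_locallyCompactSpace_rng (G g)
    exact hK.add (h.comp_clm p)
  have happ (g : S.ker →ₗ[𝕜] C) (x : E) :
      (ContinuousLinearMap.id 𝕜 E + (K + G g ∘L p)) x = S x + g (p x) := by
    simp [hS, G, add_assoc]
  have hinj (g : S.ker →ₗ[𝕜] C) (hg : Function.Injective g) :
      Function.Injective (ContinuousLinearMap.id 𝕜 E + (K + G g ∘L p)) := by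
    rw [injective_iff_map_eq_zero]
    intro x hx
    rw [happ] at hx
    have h0 := Submodule.disjoint_def.1 hC.disjoint (S x) ⟨x, rfl⟩
      (by rw [eq_neg_of_add_eq_zero_left hx]; exact C.neg_mem (g (p x)).2)
    rw [h0, zero_add, Submodule.coe_eq_zero, map_eq_zero_iff g hg] at hx
    have := hp ⟨x, h0⟩
    exact congrArg Subtype.val (this.symm.trans hx)
  have hsurj (g : S.ker →ₗ[𝕜] C) (hg : Function.Surjective g) :
      Function.Surjective (ContinuousLinearMap.id 𝕜 E + (K + G g ∘L p)) := by
    intro y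
    obtain ⟨_, ⟨x, rfl⟩, c, hc, rfl⟩ :=
      Submodule.mem_sup.1 (hC.sup_eq_top ▸ Submodule.mem_top : y ∈ S.range ⊔ C)
    obtain ⟨n, hn⟩ := hg (⟨c, hc⟩ - g (p x))
    refine ⟨x + n, ?_⟩
    have hSn : S n = 0 := n.2
    rw [happ, map_add, map_add, hp, hSn, map_add, hn]
    simp
  have key : ∃ g : S.ker →ₗ[𝕜] C, Function.Bijective g := by
    -- Cardinal ranks, as `C` is not yet known to be finite dimensional. In either case the Fredholm
    -- alternative for `S + g ∘ p` supplies the missing half of bijectivity of `g`.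
    rcases le_total (Module.rank 𝕜 S.ker) (Module.rank 𝕜 C) with h | h
    · obtain ⟨g, hg⟩ := rank_le_iff_exists_linearMap.1 h
      refine ⟨g, hg, fun c ↦ ?_⟩
      obtain ⟨x, hx⟩ := (hG g).surjective_id_add_of_injective (hinj g hg) c
      rw [happ] at hx
      refine ⟨p x, ?_⟩
      have h0 := Submodule.disjoint_def.1 hC.disjoint (S x) ⟨x, rfl⟩
        (by rw [eq_sub_of_add_eq hx]; exact C.sub_mem c.2 (g (p x)).2)
      simpa [h0] using hx
    · obtain ⟨h, hh⟩ := rank_le_iff_exists_linearMap.1 h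
      obtain ⟨g, hgh⟩ := h.exists_leftInverse_of_injective (LinearMap.ker_eq_bot.2 hh)
      have hg : Function.Surjective g := fun c ↦ ⟨h c, congr($hgh c)⟩
      refine ⟨g, ?_, hg⟩
      intro m n hmn
      have := (hG g).injective_id_add_of_surjective (hsurj g hg) (a₁ := m) (a₂ := n) (by
        have hm : S m = 0 := m.2
        have hn : S n = 0 := n.2
        rw [happ, happ, hp, hp, hmn, hm, hn])
      exact Subtype.ext this
  obtain ⟨g, hg⟩ := key
  exact ⟨(LinearEquiv.ofBijective g hg).trans (S.range.quotientEquivOfIsCompl C hC).symm⟩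

end IsCompactOperator

/-- **Invariance of the index under compact perturbations**, for Banach spaces. -/
theorem ContinuousLinearMap.finiteDimensional_and_index_add_of_isCompactOperator
    (A K : E →L[𝕜] F) [FiniteDimensional 𝕜 A.ker] [FiniteDimensional 𝕜 (F ⧸ A.range)]
    (hK : IsCompactOperator K) :
    FiniteDimensional 𝕜 (A + K).ker ∧ FiniteDimensional 𝕜 (F ⧸ (A + K).range) ∧
      (A + K).toLinearMap.index = A.toLinearMap.index := by
  obtain ⟨C, hC⟩ := A.range.exists_isCompl
  have : FiniteDimensional 𝕜 C := (A.range.quotientEquivOfIsCompl C hC).finiteDimensional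
  have := FiniteDimensional.complete 𝕜 C
  let i : E →L[𝕜] E × C := ContinuousLinearMap.inl 𝕜 E C
  let g : E × C →L[𝕜] F := A.coprod C.subtypeL
  have hgsurj : Function.Surjective g := fun y ↦ by
    obtain ⟨_, ⟨x, rfl⟩, c, hc, rfl⟩ :=
      Submodule.mem_sup.1 (hC.sup_eq_top ▸ Submodule.mem_top : y ∈ A.range ⊔ C)
    exact ⟨(x, ⟨c, hc⟩), by simp [g]⟩
  have hgi : A.toLinearMap = g.toLinearMap ∘ₗ i.toLinearMap := by
    ext x
    simp [g, i]
  have hgker : FiniteDimensional 𝕜 g.ker := by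
    -- If `A x + c = 0`, both terms lie in `ran A ∩ C = 0`, so `ker g` embeds in `ker A` by its
    -- first coordinate.
    let f : g.ker →ₗ[𝕜] A.ker := LinearMap.codRestrict A.ker
      (LinearMap.fst 𝕜 E C ∘ₗ g.ker.subtype) fun x ↦ by
        have hx : A x.1.1 + x.1.2 = 0 := by simpa [g] using x.2
        exact Submodule.disjoint_def.1 hC.disjoint _ ⟨_, rfl⟩
          (by
            change A x.1.1 ∈ C
            rw [eq_neg_of_add_eq_zero_left hx]; exact C.neg_mem x.1.2.2)
    refine FiniteDimensional.of_injective f ?_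
    rw [injective_iff_map_eq_zero]
    rintro ⟨⟨x, c⟩, hx⟩ h0
    have hx0 : x = 0 := congrArg Subtype.val h0
    subst hx0
    have : (c : F) = 0 := by simpa [g] using hx
    simpa using this
  obtain ⟨R, hR⟩ := g.exists_rightInverse_of_finiteDimensional_ker hgsurj
  let L : E × C →L[𝕜] E × C := R ∘L K ∘L ContinuousLinearMap.fst 𝕜 E C
  have hL : IsCompactOperator L :=
    (hK.comp_clm (ContinuousLinearMap.fst 𝕜 E C)).clm_comp R
  set S := ContinuousLinearMap.id 𝕜 (E × C) + L with hS
  have hAK : (A + K).toLinearMap = g.toLinearMap ∘ₗ S.toLinearMap ∘ₗ i.toLinearMap := by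
    ext x
    have : g (i x + R (K x)) = A x + K x := by rw [map_add, hR]; simp [g, i]
    exact this.symm
  obtain ⟨e⟩ := hL.nonempty_ker_equiv_coker_id_add
  have hSker : FiniteDimensional 𝕜 S.ker := hL.finiteDimensional_ker_id_add
  have hScoker : FiniteDimensional 𝕜 ((E × C) ⧸ S.range) := e.finiteDimensional
  have hSindex : S.toLinearMap.index = 0 := by
    rw [LinearMap.index_eq_finrank_sub, e.finrank_eq, sub_self]
  have hgcoker : FiniteDimensional 𝕜 (F ⧸ g.range) := by
    rw [LinearMap.range_eq_top.2 hgsurj]; infer_instance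
  have hiker : FiniteDimensional 𝕜 i.ker := by
    have : i.ker = ⊥ := LinearMap.ker_eq_bot.2 LinearMap.inl_injective
    rw [this]
    infer_instance
  have hicoker : FiniteDimensional 𝕜 ((E × C) ⧸ i.range) := by
    have : i.range = LinearMap.ker (LinearMap.snd 𝕜 E C) := LinearMap.range_inl 𝕜 E C
    rw [this]
    exact ((LinearMap.snd 𝕜 E C).quotKerEquivOfSurjective LinearMap.snd_surjective).symm
      |>.finiteDimensional
  have hSi : FiniteDimensional 𝕜 (S.toLinearMap ∘ₗ i.toLinearMap).ker := by
    rw [LinearMap.ker_comp]; infer_instance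
  have hSi' : FiniteDimensional 𝕜 ((E × C) ⧸ (S.toLinearMap ∘ₗ i.toLinearMap).range) := by
    rw [LinearMap.range_comp]; infer_instance
  rw [hAK]
  refine ⟨by rw [LinearMap.ker_comp]; infer_instance,
    by rw [LinearMap.range_comp]; infer_instance, ?_⟩
  rw [LinearMap.index_comp, LinearMap.index_comp, hSindex, zero_add, hgi, LinearMap.index_comp]

end CompactPerturbation

/-! ### Passage from quaternionic to real scalars -/

namespace RightQuaternionic

section RestrictScalars

variable {V U : Type*} [AddCommGroup V] [Module ℍᵐᵒᵖ V] [Module ℝ V] [IsScalarTower ℝ ℍᵐᵒᵖ V]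
  [AddCommGroup U] [Module ℍᵐᵒᵖ U] [Module ℝ U] [IsScalarTower ℝ ℍᵐᵒᵖ U]

theorem finrank_real_op_quaternion : Module.finrank ℝ ℍᵐᵒᵖ = 4 := by
  rw [MulOpposite.finrank, Quaternion.finrank_eq_four]

variable (V) in
theorem finiteDimensional_real_iff : FiniteDimensional ℝ V ↔ FiniteDimensional ℍᵐᵒᵖ V :=
  ⟨fun _ ↦ Module.Finite.of_restrictScalars_finite ℝ ℍᵐᵒᵖ V, fun _ ↦ Module.Finite.trans ℍᵐᵒᵖ V⟩

variable (V) in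
theorem finrank_real : Module.finrank ℝ V = 4 * Module.finrank ℍᵐᵒᵖ V := by
  rw [← finrank_real_op_quaternion, Module.finrank_mul_finrank]

theorem finiteDimensional_ker_restrictScalars_iff (f : V →ₗ[ℍᵐᵒᵖ] U) :
    FiniteDimensional ℝ (f.restrictScalars ℝ).ker ↔ FiniteDimensional ℍᵐᵒᵖ f.ker :=
  finiteDimensional_real_iff f.ker

theorem finiteDimensional_coker_restrictScalars_iff (f : V →ₗ[ℍᵐᵒᵖ] U) :
    FiniteDimensional ℝ (U ⧸ (f.restrictScalars ℝ).range) ↔ FiniteDimensional ℍᵐᵒᵖ (U ⧸ f.range) :=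
  (Module.Finite.equiv_iff (Submodule.Quotient.restrictScalarsEquiv ℝ f.range)).trans
    (finiteDimensional_real_iff _)

theorem index_restrictScalars (f : V →ₗ[ℍᵐᵒᵖ] U) :
    (f.restrictScalars ℝ).index = 4 * f.index := by
  have hker : Module.finrank ℝ (f.restrictScalars ℝ).ker = 4 * Module.finrank ℍᵐᵒᵖ f.ker :=
    finrank_real f.ker
  have hcoker : Module.finrank ℝ (U ⧸ (f.restrictScalars ℝ).range) =
      4 * Module.finrank ℍᵐᵒᵖ (U ⧸ f.range) :=
    (Submodule.Quotient.restrictScalarsEquiv ℝ f.range).finrank_eq.trans (finrank_real _)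
  rw [LinearMap.index_eq_finrank_sub, LinearMap.index_eq_finrank_sub, hker, hcoker]
  push_cast
  ring

end RestrictScalars

section NormedSpace

variable (V : Type*) [NormedAddCommGroup V] [Module ℍᵐᵒᵖ V]

/-- The real vector space underlying a right quaternionic vector space. -/
noncomputable abbrev realModule : Module ℝ V := Module.compHom V (algebraMap ℝ ℍᵐᵒᵖ)

theorem isScalarTower_realModule :
    letI := realModule V
    IsScalarTower ℝ ℍᵐᵒᵖ V :=
  letI := realModule V
  ⟨fun r q v ↦ by
    change (r • q) • v = algebraMap ℝ ℍᵐᵒᵖ r • q • v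
    rw [Algebra.smul_def, mul_smul]⟩

variable {V} [RightQuaternionicHilbertSpace V]

/-- `⟨v q ∣ v q⟩ = q̄ ⟨v ∣ v⟩ q`, and the middle factor is real, hence central. -/
theorem norm_op_smul (q : ℍ) (v : V) : ‖MulOpposite.op q • v‖ = ‖q‖ * ‖v‖ := by
  have h1 : (((‖MulOpposite.op q • v‖ ^ 2 : ℝ)) : ℍ) = ((‖q‖ * ‖v‖) ^ 2 : ℝ) := by
    rw [← RightQuaternionicHilbertSpace.inner_self_eq,
      RightQuaternionicHilbertSpace.inner_op_smul_right,
      ← RightQuaternionicHilbertSpace.star_inner,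
      RightQuaternionicHilbertSpace.inner_op_smul_right, star_mul,
      RightQuaternionicHilbertSpace.star_inner,
      RightQuaternionicHilbertSpace.inner_self_eq, mul_assoc, Quaternion.coe_commutes, ← mul_assoc,
      Quaternion.star_mul_self, Quaternion.normSq_eq_norm_mul_self, ← Quaternion.coe_mul]
    congr 1
    ring
  exact (pow_left_inj₀ (norm_nonneg _) (by positivity) two_ne_zero).1 (Quaternion.coe_injective h1)

variable (V) in
/-- The real Banach space underlying a right quaternionic Hilbert space. -/
noncomputable abbrev realNormedSpace : NormedSpace ℝ V where
  toModule := realModule V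
  norm_smul_le r v := by
    change ‖MulOpposite.op (algebraMap ℝ ℍ r) • v‖ ≤ ‖r‖ * ‖v‖
    rw [norm_op_smul, norm_algebraMap']

end NormedSpace

end RightQuaternionic

theorem theorem6p15 {V U : Type*}
    [NormedAddCommGroup V] [Module ℍᵐᵒᵖ V] [RightQuaternionicHilbertSpace V]
    [NormedAddCommGroup U] [Module ℍᵐᵒᵖ U] [RightQuaternionicHilbertSpace U]
    (A : V →L[ℍᵐᵒᵖ] U) (hA : RightQuaternionic.IsFredholm A)
    (K : V →L[ℍᵐᵒᵖ] U) (hK : IsCompactOperator K) :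
    RightQuaternionic.IsFredholm (A + K) ∧
      RightQuaternionic.index (A + K) = RightQuaternionic.index A := by
  let := RightQuaternionic.realNormedSpace V
  let := RightQuaternionic.realNormedSpace U
  have : IsScalarTower ℝ ℍᵐᵒᵖ V := RightQuaternionic.isScalarTower_realModule V
  have : IsScalarTower ℝ ℍᵐᵒᵖ U := RightQuaternionic.isScalarTower_realModule U
  have := (RightQuaternionic.finiteDimensional_ker_restrictScalars_iff A.toLinearMap).2 hA.1
  have := (RightQuaternionic.finiteDimensional_coker_restrictScalars_iff A.toLinearMap).2 hA.2
  -- Compactness of an operator involves only the topology, so `hK` applies unchanged over `ℝ`.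
  obtain ⟨hker, hcoker, hindex⟩ :=
    (⟨A.toLinearMap.restrictScalars ℝ, A.continuous⟩ :
      V →L[ℝ] U).finiteDimensional_and_index_add_of_isCompactOperator
        ⟨K.toLinearMap.restrictScalars ℝ, K.continuous⟩ hK
  refine ⟨⟨(RightQuaternionic.finiteDimensional_ker_restrictScalars_iff
      (A + K).toLinearMap).1 hker,
    (RightQuaternionic.finiteDimensional_coker_restrictScalars_iff (A + K).toLinearMap).1 hcoker⟩,
    ?_⟩
  have h : 4 * (A + K).toLinearMap.index = 4 * A.toLinearMap.index := by
    rw [← RightQuaternionic.index_restrictScalars, ← RightQuaternionic.index_restrictScalars]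
    exact hindex
  exact mul_left_cancel₀ four_ne_zero h
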